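/- Let $\xi(s)=\tfrac12 s(s-1)\pi^{-s/2}\Gamma(s/2)\zeta(s)$ be the (entire) Riemann xi function, so that $\xi(1)=\tfrac12$. For $n\ge 1$ let $\varphi_n$ be the coefficient of $z^n$ in the Taylor expansion at $z=0$ of $2\,\xi\!\left(\frac{1}{1-z}\right)$, and let $\lambda_n$ ($n\ge1$) be the Li–Keiper coefficients, defined by $\log\left(2\,\xi\!\left(\frac{1}{1-z}\right)\right)=\sum_{n\ge1}\frac{\lambda_n}{n}z^n$ near $z=0$. Put $$\delta_2=\frac{\xi''(1)}{2\,\xi(1)}-\lambda_1,\qquad \delta_k=\frac{\xi^{(k)}(1)}{k!\,\xi(1)}\quad(k\ge3),\qquad \varepsilon_n=\varphi_n-n\lambda_1 .$$ Then all these numbers $\varphi_n$, $\lambda_1$, $\delta_k$, $\varepsilon_n$ ($n\ge1$, $k\ge2$) are real, and: 1. $\varphi_1=\lambda_1=1+\frac{\gamma}{2}-\frac12\log(4\pi)$, where $\gamma$ is the Euler–Mascheroni constant; 2. $\delta_k>0$ for every $k\ge2$; 3. for every integer $n>1$, $$\varphi_n=n\lambda_1+\sum_{k=1}^{n-1}\binom{n-1}{k}\delta_{k+1},\qquad\text{i.e.}\qquad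 \varepsilon_n=\sum_{k=1}^{n-1}\binom{n-1}{k}\delta_{k+1};$$ 4. $\varepsilon_n>0$ for every $n>1$, and $\varepsilon_n$ is strictly increasing in $n$ for $n>1$; 5. $\varphi_n>n\lambda_1$ for every $n>1$. -/

import Mathlib

open scoped ComplexOrder

noncomputable section

/-- The Riemann xi function `ξ(s) = (1/2) s (s - 1) π^(-s/2) Γ(s/2) ζ(s)`, as an entire function.
Mathlib's entire function `Λ₀` satisfies `π^(-s/2) Γ(s/2) ζ(s) = Λ₀(s) - 1/s - 1/(1 - s)`, so the
product is written here in the form which has the removable singularities removed;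
see `riemannXi_eq` for the agreement with the usual formula. -/
def riemannXi (s : ℂ) : ℂ :=
  (s * (s - 1) * completedRiemannZeta₀ s + 1) / 2

/-- The Xi function in the variable `z = 1 - 1/s`, that is `s = 1/(1 - z)`, normalized to be `1`
at `z = 0`: `z ↦ 2 ξ(1/(1 - z))`. -/
def xiPartition (z : ℂ) : ℂ :=
  2 * riemannXi (1 / (1 - z))

/-- `φ_n`: the coefficient of `z^n` in the Taylor expansion of `2 ξ(1/(1 - z))` at `z = 0`. -/
def phiCoeff (n : ℕ) : ℂ :=
  iteratedDeriv n xiPartition 0 / (n.factorial : ℂ)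

/-- The Li-Keiper coefficient `λ_n`: `λ_n / n` is the coefficient of `z^n` in the Taylor expansion
of `log (2 ξ(1/(1 - z)))` at `z = 0` (where `2 ξ(1/(1 - z))` takes the value `1`). -/
def liKeiper (n : ℕ) : ℂ :=
  (n : ℂ) * (iteratedDeriv n (fun z : ℂ => Complex.log (xiPartition z)) 0 / (n.factorial : ℂ))

/-- `δ_2 = ξ''(1) / (2! ξ(1)) - λ_1`, and `δ_k = ξ^(k)(1) / (k! ξ(1))` for `k ≥ 3`
(only the indices `k ≥ 2` are used). -/
def xiDelta (k : ℕ) : ℂ :=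
  if k = 2 then iteratedDeriv 2 riemannXi 1 / (2 * riemannXi 1) - liKeiper 1
  else iteratedDeriv k riemannXi 1 / ((k.factorial : ℂ) * riemannXi 1)

/-- `ε_n = φ_n - n λ_1`, the excess of `φ_n` over the linear term. -/
def phiExcess (n : ℕ) : ℂ :=
  phiCoeff n - (n : ℂ) * liKeiper 1

theorem riemannXi_eq {s : ℂ} (hs : 0 < s.re) (hs1 : s ≠ 1) :
    riemannXi s =
      1 / 2 * s * (s - 1) * (Real.pi : ℂ) ^ (-s / 2) * Complex.Gamma (s / 2) * riemannZeta s := by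
  have h0 : s ≠ 0 := by
    rintro rfl
    simp at hs
  have h1 : (1 : ℂ) - s ≠ 0 := sub_ne_zero.mpr (Ne.symm hs1)
  have hG : Complex.Gammaℝ s ≠ 0 := Complex.Gammaℝ_ne_zero_of_re_pos hs
  have hz := riemannZeta_def_of_ne_zero h0
  have hL : (Real.pi : ℂ) ^ (-s / 2) * Complex.Gamma (s / 2) * riemannZeta s
      = completedRiemannZeta s := by
    rw [← Complex.Gammaℝ_def, hz]
    field_simp
  rw [mul_assoc, mul_assoc, ← mul_assoc (_ ^ _), hL, completedRiemannZeta_eq, riemannXi]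
  field_simp
  ring

theorem differentiable_riemannXi : Differentiable ℂ riemannXi := by
  unfold riemannXi
  have := differentiable_completedZeta₀
  fun_prop

theorem riemannXi_one : riemannXi 1 = 1 / 2 := by
  simp [riemannXi]

end

/-!
Write `Λ₀` for `completedRiemannZeta₀`, so that `2 ξ(s) = 1 + (s ^ 2 - s) Λ₀(s)`, and let `c_j` be
the Taylor coefficients of `Λ₀` at `s = 1`. With `t = s - 1` one has `s ^ 2 - s = t + t ^ 2`, so the
Taylor coefficient of `2 ξ` at `1` of order `1` is `c_0`, and that of order `k ≥ 2` is
`c_{k-1} + c_{k-2}`. Hence `λ_1 = φ_1 = c_0 = Λ₀(1)`, whose value in terms of `γ` is in Mathlib, and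
`δ_2 = c_1`, while `δ_k = c_{k-1} + c_{k-2}` for `k ≥ 3`. The positivity of the `δ_k` therefore
follows from that of the `c_j` (`completedZetaDeriv_one_pos`).

For this, Riemann's integral (`completedRiemannZeta₀_eq_mellin`) gives
`Λ₀(s) = (M(s/2) + M((1-s)/2)) / 2`, where `M` is the Mellin transform of
`θ(t) = ∑_{n ≠ 0} exp (-π n² t)` restricted to `t > 1`. Differentiating `j` times under the integral
inserts `log t ^ j`, and at `s = 1` the result is a positive multiple of
`M_j(1/2) + (-1)^j M_j(0)` with `M_j(σ) = ∫_1^∞ t^(σ-1) (log t)^j θ(t) dt`. Since `log t > 0` and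
`θ(t) > 0` for `t > 1`, the moment `M_j` is nonnegative and strictly increasing in `σ`
(`thetaMoment_strictMono`), which makes the combination positive for either sign.

Finally, substituting `t = z / (1 - z)`, where `z ^ n` has coefficient `(n-1).choose (k-1)` in
`t ^ k` (`iteratedDeriv_succ_comp_one_div_one_sub`), expresses `φ_n` as a binomial sum of the Taylor
coefficients of `2 ξ` at `1`. Splitting off the `λ_1` contained in the first two of these produces
exactly `n λ_1`, and the rest is the positive sum `ε_n`, whose binomial coefficients grow with `n`.
-/

/-! ### Iterated derivatives along a chain of functions -/

/-- If each `F j` has derivative `F (j + 1)`, then `F n` is the `n`-th derivative of `F 0`. -/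
theorem iteratedDeriv_eq_of_hasDerivAt_succ {F : ℕ → ℂ → ℂ}
    (hF : ∀ j s, HasDerivAt (F j) (F (j + 1) s) s) (n : ℕ) : iteratedDeriv n (F 0) = F n := by
  induction n with
  | zero => exact iteratedDeriv_zero
  | succ n ih =>
    rw [iteratedDeriv_succ, ih]
    exact funext fun s ↦ (hF n s).deriv

/-- The derivatives of `G (1 / (1 - z))` at any `z ≠ 1`, as a sum over the derivatives of `G` at
`1 / (1 - z)` with the Lah numbers `(n + 1)! / (k + 1)! * n.choose k` as coefficients. The point
`z` is kept general so that the induction on `n` can differentiate. -/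
theorem iteratedDeriv_succ_comp_one_div_one_sub {G : ℂ → ℂ} {F : ℕ → ℂ → ℂ} (hF0 : F 0 = G)
    (hF : ∀ j s, HasDerivAt (F j) (F (j + 1) s) s) (n : ℕ) {z : ℂ} (hz : z ≠ 1) :
    iteratedDeriv (n + 1) (fun z ↦ G (1 / (1 - z))) z = ((n + 1).factorial : ℂ) *
      ∑ k ∈ Finset.range (n + 1), (n.choose k : ℂ) / ((k + 1).factorial : ℂ) *
        ((1 / (1 - z)) ^ (n + k + 2) * F (k + 1) (1 / (1 - z))) := by
  have hs : ∀ w : ℂ, w ≠ 1 → HasDerivAt (fun z : ℂ ↦ 1 / (1 - z)) ((1 / (1 - w)) ^ 2) w := by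
    intro w hw
    have h1 : (1 : ℂ) - w ≠ 0 := sub_ne_zero.mpr hw.symm
    have h := ((hasDerivAt_id w).const_sub 1).inv h1
    simp only [one_div]
    refine h.congr_deriv ?_
    simp [inv_pow]
  have hcomp : ∀ (j : ℕ) (w : ℂ), w ≠ 1 → HasDerivAt (fun z : ℂ ↦ F j (1 / (1 - z)))
      (F (j + 1) (1 / (1 - w)) * (1 / (1 - w)) ^ 2) w := fun j w hw ↦
    (hF j _).comp w (hs w hw)
  induction n generalizing z with
  | zero =>
    subst hF0
    rw [zero_add, iteratedDeriv_one, (hcomp 0 z hz).deriv]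
    simp [mul_comm]
  | succ n ih =>
    have hev : iteratedDeriv (n + 1) (fun z ↦ G (1 / (1 - z))) =ᶠ[nhds z] fun z ↦
        ((n + 1).factorial : ℂ) *
      ∑ k ∈ Finset.range (n + 1), (n.choose k : ℂ) / ((k + 1).factorial : ℂ) *
        ((1 / (1 - z)) ^ (n + k + 2) * F (k + 1) (1 / (1 - z))) := by
      filter_upwards [isOpen_ne.mem_nhds hz] with w hw using ih hw
    rw [iteratedDeriv_succ, hev.deriv_eq]
    have hd := (HasDerivAt.fun_sum fun k (_ : k ∈ Finset.range (n + 1)) ↦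
      (((hs z hz).pow (n + k + 2)).mul (hcomp (k + 1) z hz)).const_mul
        ((n.choose k : ℂ) / ((k + 1).factorial : ℂ))).const_mul ((n + 1).factorial : ℂ)
    refine hd.deriv.trans ?_
    set s := 1 / (1 - z)
    rw [Nat.factorial_succ (n + 1), Nat.cast_mul, mul_comm ((n + 1 + 1 : ℕ) : ℂ), mul_assoc]
    congr 1
    -- The two halves of the derivative of the `k`-th term feed the terms `k` and `k + 1` of the
    -- new sum.
    have hL : ∀ k ∈ Finset.range (n + 1), (n.choose k : ℂ) / ((k + 1).factorial : ℂ) *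
        (((n + k + 2 : ℕ) : ℂ) * s ^ (n + k + 2 - 1) * s ^ 2 * F (k + 1) s +
          s ^ (n + k + 2) * (F (k + 1 + 1) s * s ^ 2)) =
        (n.choose k : ℂ) / ((k + 1).factorial : ℂ) * (n + k + 2) * (s ^ (n + 1 + k + 2) *
          F (k + 1) s) + (n.choose k : ℂ) / ((k + 1).factorial : ℂ) *
            (s ^ (n + 1 + (k + 1) + 2) * F (k + 1 + 1) s) := by
      intro k _
      rw [show n + k + 2 - 1 = n + k + 1 by omega]
      push_cast
      ring
    refine (Finset.sum_congr rfl hL).trans ?_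
    rw [Finset.sum_add_distrib, Finset.sum_range_succ' _ (n + 1), mul_add, Finset.mul_sum]
    -- The first half is shifted by one index; its top term vanishes, as `n.choose (n + 1) = 0`.
    have hA : ∑ k ∈ Finset.range (n + 1), (n.choose k : ℂ) / ((k + 1).factorial : ℂ) *
          (n + k + 2) * (s ^ (n + 1 + k + 2) * F (k + 1) s) =
        ∑ k ∈ Finset.range (n + 1), (n.choose (k + 1) : ℂ) / ((k + 1 + 1).factorial : ℂ) *
          (n + (k + 1) + 2) * (s ^ (n + 1 + (k + 1) + 2) * F (k + 1 + 1) s) +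
          (n + 2) * (s ^ (n + 1 + 2) * F 1 s) := by
      have h := Finset.sum_range_succ (fun k ↦ (n.choose k : ℂ) / ((k + 1).factorial : ℂ) *
          (n + k + 2) * (s ^ (n + 1 + k + 2) * F (k + 1) s)) (n + 1)
      rw [Finset.sum_range_succ'] at h
      simp only [Nat.choose_succ_self, Nat.cast_zero, zero_div, zero_mul, add_zero] at h
      rw [← h]
      simp
    rw [hA, add_right_comm, ← Finset.sum_add_distrib]
    congr 1
    · refine Finset.sum_congr rfl fun k hk ↦ ?_
      have hk' : k ≤ n := by have := Finset.mem_range.mp hk; omega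
      have hch : ((n.choose (k + 1) : ℂ)) * (k + 1) = n.choose k * (n - k) := by
        have := Nat.choose_succ_right_eq n k
        rw [← Nat.cast_sub hk']
        exact_mod_cast this
      rw [Nat.choose_succ_succ, Nat.factorial_succ (k + 1)]
      have hf : ((k + 1).factorial : ℂ) ≠ 0 := by exact_mod_cast (k + 1).factorial_ne_zero
      have hk2 : (k : ℂ) + 1 + 1 ≠ 0 := by exact_mod_cast (k + 1).succ_ne_zero
      push_cast
      field_simp
      linear_combination (s ^ (n + 1 + (k + 1) + 2) * F (k + 1 + 1) s) * hch
    · simp only [Nat.choose_zero_right, zero_add, Nat.factorial_one, add_zero]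
      push_cast
      ring

section ThetaTail

open Set Filter Topology Asymptotics MeasureTheory HurwitzZeta

/-! ### The theta tail and its logarithmic moments -/

/-- The theta function `∑_{n ∈ ℤ} exp (-π n² t)` without its constant term, cut off to `t > 1`. -/
noncomputable def thetaTail (t : ℝ) : ℝ :=
  (Ioi (1 : ℝ)).indicator (fun x ↦ evenKernel 0 x - 1) t

theorem thetaTail_pos {t : ℝ} (ht : 1 < t) : 0 < thetaTail t := by
  rw [thetaTail, indicator_of_mem (mem_Ioi.mpr ht)]
  have h := hasSum_int_evenKernel₀ 0 (zero_lt_one.trans ht)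
  simp only [QuotientAddGroup.mk_zero, if_true] at h
  rw [← h.tsum_eq]
  refine h.summable.tsum_pos (fun n ↦ ?_) 1 ?_
  · split_ifs <;> positivity
  · simp [Real.exp_pos]

theorem thetaTail_of_le {t : ℝ} (ht : t ≤ 1) : thetaTail t = 0 :=
  indicator_of_notMem (notMem_Ioi.mpr ht) _

/-- The integrand of the `j`-th logarithmic moment: `log t ^ j` times the theta tail, with complex
values so that it can be fed to `mellin`. -/
noncomputable def logThetaTail (j : ℕ) (t : ℝ) : ℂ :=
  ((Real.log t ^ j * thetaTail t : ℝ) : ℂ)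

theorem locallyIntegrableOn_logThetaTail (j : ℕ) :
    LocallyIntegrableOn (logThetaTail j) (Ioi 0) := by
  have hc : ContinuousOn (fun t : ℝ ↦ ((Real.log t ^ j * (evenKernel 0 t - 1) : ℝ) : ℂ))
      (Ioi 0) := by
    refine Complex.continuous_ofReal.comp_continuousOn (ContinuousOn.mul ?_ ?_)
    · exact (Real.continuousOn_log.mono fun x hx ↦ (ne_of_gt hx)).pow j
    · exact (continuousOn_evenKernel 0).sub continuousOn_const
  have heq : logThetaTail j = (Ioi (1 : ℝ)).indicator
      (fun t : ℝ ↦ ((Real.log t ^ j * (evenKernel 0 t - 1) : ℝ) : ℂ)) := by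
    funext t
    by_cases ht : t ∈ Ioi (1 : ℝ) <;> simp [logThetaTail, thetaTail, ht]
  rw [heq]
  intro x hx
  obtain ⟨s, hs, hs'⟩ := hc.locallyIntegrableOn (μ := volume) measurableSet_Ioi x hx
  exact ⟨s, hs, hs'.indicator measurableSet_Ioi⟩

theorem logThetaTail_isBigO_atTop (j : ℕ) (a : ℝ) :
    logThetaTail j =O[atTop] (fun t : ℝ ↦ t ^ (-a)) := by
  induction j generalizing a with
  | zero =>
    have h := (hurwitzEvenFEPair 0).hf_top (-a)
    refine h.congr' ?_ .rfl
    filter_upwards [eventually_gt_atTop 1] with t ht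
    simp [logThetaTail, thetaTail, hurwitzEvenFEPair, ht]
  | succ j ih =>
    refine (isBigO_rpow_top_log_smul (lt_add_one a) (ih (a + 1))).congr_left fun t ↦ ?_
    simp [logThetaTail, pow_succ']
    ring

theorem logThetaTail_isBigO_zero (j : ℕ) (b : ℝ) :
    logThetaTail j =O[𝓝[>] 0] (fun t : ℝ ↦ t ^ (-b)) := by
  refine (isBigO_zero (fun t : ℝ ↦ t ^ (-b)) _).congr' ?_ .rfl
  have : Iio (1 : ℝ) ∈ 𝓝[>] (0 : ℝ) := mem_nhdsWithin_of_mem_nhds (Iio_mem_nhds one_pos)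
  filter_upwards [this] with t ht
  simp [logThetaTail, thetaTail_of_le (le_of_lt ht)]

theorem mellinConvergent_logThetaTail (j : ℕ) (s : ℂ) : MellinConvergent (logThetaTail j) s :=
  mellinConvergent_of_isBigO_rpow (locallyIntegrableOn_logThetaTail j)
    (logThetaTail_isBigO_atTop j (s.re + 1)) (lt_add_one _)
    (logThetaTail_isBigO_zero j (s.re - 1)) (sub_one_lt _)

theorem hasDerivAt_mellin_logThetaTail (j : ℕ) (s : ℂ) :
    HasDerivAt (mellin (logThetaTail j)) (mellin (logThetaTail (j + 1)) s) s := by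
  refine (mellin_hasDerivAt_of_isBigO_rpow (locallyIntegrableOn_logThetaTail j)
    (logThetaTail_isBigO_atTop j (s.re + 1)) (lt_add_one _)
    (logThetaTail_isBigO_zero j (s.re - 1)) (sub_one_lt _)).2.congr_deriv ?_
  congr 1
  funext t
  simp [logThetaTail, pow_succ']
  ring

/-- The real logarithmic moment `∫ t ^ (σ - 1) log t ^ j θ(t) dt` of the theta tail `θ`. -/
noncomputable def thetaMoment (j : ℕ) (σ : ℝ) : ℝ :=
  ∫ t in Ioi (0 : ℝ), t ^ (σ - 1) * (Real.log t ^ j * thetaTail t)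

theorem cpow_smul_logThetaTail (j : ℕ) (σ : ℝ) {t : ℝ} (ht : 0 < t) :
    (t : ℂ) ^ ((σ : ℂ) - 1) • logThetaTail j t =
      ((t ^ (σ - 1) * (Real.log t ^ j * thetaTail t) : ℝ) : ℂ) := by
  rw [logThetaTail, smul_eq_mul, Complex.ofReal_mul (t ^ (σ - 1)), Complex.ofReal_cpow ht.le]
  push_cast
  rfl

theorem mellin_logThetaTail_ofReal (j : ℕ) (σ : ℝ) :
    mellin (logThetaTail j) (σ : ℂ) = (thetaMoment j σ : ℂ) := by
  rw [mellin, thetaMoment, ← integral_complex_ofReal]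
  exact setIntegral_congr_fun measurableSet_Ioi fun t ht ↦ cpow_smul_logThetaTail j σ ht

theorem integrableOn_thetaMoment (j : ℕ) (σ : ℝ) :
    IntegrableOn (fun t : ℝ ↦ t ^ (σ - 1) * (Real.log t ^ j * thetaTail t)) (Ioi 0) := by
  have h := mellinConvergent_logThetaTail j (σ : ℂ)
  refine ((integrableOn_congr_fun (fun t ht ↦ cpow_smul_logThetaTail j σ ht)
    measurableSet_Ioi).mp h).re.congr (ae_of_all _ fun t ↦ ?_)
  exact Complex.ofReal_re _

theorem log_pow_mul_thetaTail_nonneg (j : ℕ) (t : ℝ) : 0 ≤ Real.log t ^ j * thetaTail t := by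
  rcases le_or_gt t 1 with h | h
  · simp [thetaTail_of_le h]
  · exact mul_nonneg (pow_nonneg (Real.log_nonneg h.le) j) (thetaTail_pos h).le

theorem thetaMoment_nonneg (j : ℕ) (σ : ℝ) : 0 ≤ thetaMoment j σ :=
  setIntegral_nonneg measurableSet_Ioi fun t ht ↦
    mul_nonneg (Real.rpow_nonneg (le_of_lt ht) _) (log_pow_mul_thetaTail_nonneg j t)

theorem thetaMoment_strictMono (j : ℕ) : StrictMono (thetaMoment j) := by
  intro τ σ h
  rw [← sub_pos, thetaMoment, thetaMoment,
    ← integral_sub (integrableOn_thetaMoment j σ) (integrableOn_thetaMoment j τ)]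
  have hpos : ∀ t : ℝ, 1 < t → 0 < t ^ (σ - 1) * (Real.log t ^ j * thetaTail t) -
      t ^ (τ - 1) * (Real.log t ^ j * thetaTail t) := fun t ht ↦ by
    rw [← sub_mul]
    exact mul_pos (sub_pos.mpr (Real.rpow_lt_rpow_of_exponent_lt ht (by linarith)))
      (mul_pos (pow_pos (Real.log_pos ht) j) (thetaTail_pos ht))
  rw [setIntegral_pos_iff_support_of_nonneg_ae]
  · refine lt_of_lt_of_le ?_ (measure_mono (s := Ioi (1 : ℝ)) fun t ht ↦
      ⟨(hpos t ht).ne', zero_lt_one.trans (mem_Ioi.mp ht)⟩)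
    simp
  · refine ae_of_all _ fun t ↦ ?_
    rcases le_or_gt t 1 with ht | ht
    · simp [thetaTail_of_le ht]
    · exact (hpos t ht).le
  · exact (integrableOn_thetaMoment j σ).sub (integrableOn_thetaMoment j τ)

/-! ### Taylor coefficients of the completed zeta function at `1` -/

/-- Riemann's splitting of the Mellin integral at `t = 1`: the part over `(0, 1)` is moved to
`(1, ∞)` by the inversion `t ↦ 1 / t` and the functional equation of the theta function. -/
theorem completedRiemannZeta₀_eq_mellin (s : ℂ) :
    completedRiemannZeta₀ s =
      (mellin (logThetaTail 0) (s / 2) + mellin (logThetaTail 0) ((1 - s) / 2)) / 2 := by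
  have hmod : ∀ t ∈ Ioi (0 : ℝ), (hurwitzEvenFEPair 0).f_modif t =
      logThetaTail 0 t + (t : ℂ) ^ (-(1 / 2) : ℂ) • logThetaTail 0 t⁻¹ := by
    intro t ht
    have ht0 : (0 : ℝ) < t := ht
    rcases lt_trichotomy t 1 with h | rfl | h
    · have hinv : 1 < t⁻¹ := (one_lt_inv₀ ht0).mpr h
      have hfe := evenKernel_functional_equation 0 t
      rw [← evenKernel_eq_cosKernel_of_zero, one_div t] at hfe
      have hc : (t : ℂ) ^ (-(1 / 2) : ℂ) = ((1 / t ^ (1 / 2 : ℝ) : ℝ) : ℂ) := by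
        rw [one_div (t ^ _), ← Real.rpow_neg ht0.le, Complex.ofReal_cpow ht0.le]
        push_cast
        rfl
      rw [hc, WeakFEPair.f_modif]
      simp only [Pi.add_apply, hurwitzEvenFEPair, logThetaTail, thetaTail, mem_Ioi, mem_Ioo,
        indicator, h, ht0, hinv, not_lt_of_gt h, Function.comp_apply, hfe, Real.rpow_neg ht0.le]
      simp
      ring
    · simp [WeakFEPair.f_modif, logThetaTail, thetaTail]
    · have hinv : ¬ 1 < t⁻¹ := not_lt_of_gt (inv_lt_one_of_one_lt₀ h)
      simp [WeakFEPair.f_modif, logThetaTail, thetaTail, hurwitzEvenFEPair, h, hinv,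
        not_lt_of_gt h]
  have h2 : ∀ w : ℂ, mellin (fun t : ℝ ↦ (t : ℂ) ^ (-(1 / 2) : ℂ) • logThetaTail 0 t⁻¹) w =
      mellin (logThetaTail 0) (1 / 2 - w) := fun w ↦ by
    rw [mellin_cpow_smul (fun t ↦ logThetaTail 0 t⁻¹), mellin_comp_inv]
    congr 1
    ring
  have h3 : ∀ w : ℂ, MellinConvergent
      (fun t : ℝ ↦ (t : ℂ) ^ (-(1 / 2) : ℂ) • logThetaTail 0 t⁻¹) w := fun w ↦ by
    rw [MellinConvergent.cpow_smul (f := fun t ↦ logThetaTail 0 t⁻¹)]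
    have := (MellinConvergent.comp_rpow (f := logThetaTail 0) (s := w + -(1 / 2)) (a := -1)
      (by norm_num)).mpr (mellinConvergent_logThetaTail 0 _)
    simpa only [Real.rpow_neg_one] using this
  change mellin (hurwitzEvenFEPair 0).f_modif (s / 2) / 2 = _
  congr 1
  have h4 := (hasMellin_add (mellinConvergent_logThetaTail 0 (s / 2)) (h3 (s / 2))).2
  rw [h2, show 1 / 2 - s / 2 = (1 - s) / 2 by ring] at h4
  rw [← h4]
  exact setIntegral_congr_fun measurableSet_Ioi fun t ht ↦ by
    simp only [hmod t ht]

/-- The `j`-th derivative of `completedRiemannZeta₀`, written through logarithmic moments. -/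
noncomputable def completedZetaDeriv (j : ℕ) (s : ℂ) : ℂ :=
  (1 / 2) ^ (j + 1) * (mellin (logThetaTail j) (s / 2) +
    (-1) ^ j * mellin (logThetaTail j) ((1 - s) / 2))

theorem completedZetaDeriv_zero : completedZetaDeriv 0 = completedRiemannZeta₀ := by
  funext s
  rw [completedRiemannZeta₀_eq_mellin, completedZetaDeriv]
  ring

theorem hasDerivAt_completedZetaDeriv (j : ℕ) (s : ℂ) :
    HasDerivAt (completedZetaDeriv j) (completedZetaDeriv (j + 1) s) s := by
  have h1 : HasDerivAt (fun s : ℂ ↦ s / 2) (1 / 2) s := (hasDerivAt_id s).div_const 2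
  have h2 : HasDerivAt (fun s : ℂ ↦ (1 - s) / 2) (-1 / 2) s :=
    ((hasDerivAt_id s).const_sub 1).div_const 2
  have h3 := (hasDerivAt_mellin_logThetaTail j (s / 2)).comp s h1
  have h4 := (hasDerivAt_mellin_logThetaTail j ((1 - s) / 2)).comp s h2
  refine ((h3.add (h4.const_mul ((-1) ^ j))).const_mul ((1 / 2) ^ (j + 1))).congr_deriv ?_
  rw [completedZetaDeriv]
  ring

/-- All derivatives of `completedRiemannZeta₀` at `1` are positive: for odd order the subtracted
moment, of exponent `0`, is smaller than the one of exponent `1 / 2`. -/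
theorem completedZetaDeriv_one_pos (j : ℕ) : 0 < completedZetaDeriv j 1 := by
  have hlt := thetaMoment_strictMono j (show (0 : ℝ) < 1 / 2 by norm_num)
  have h0 := thetaMoment_nonneg j 0
  have hval : completedZetaDeriv j 1 =
      (((1 / 2) ^ (j + 1) * (thetaMoment j (1 / 2) + (-1) ^ j * thetaMoment j 0) : ℝ) : ℂ) := by
    have e1 := mellin_logThetaTail_ofReal j (1 / 2)
    have e2 := mellin_logThetaTail_ofReal j 0
    push_cast at e1 e2 ⊢
    rw [completedZetaDeriv, sub_self, zero_div, e1, e2]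
  rw [hval, Complex.zero_lt_real]
  refine mul_pos (by positivity) ?_
  rcases neg_one_pow_eq_or ℝ j with h | h <;> rw [h] <;> linarith

end ThetaTail

/-! ### Derivatives of the xi function -/

/-- The `n`-th derivative of `riemannXi`, as given by the Leibniz rule applied to
`(s ^ 2 - s) * completedRiemannZeta₀ s`. The truncated indices `n - 1` and `n - 2` occur only with
a vanishing factor. -/
noncomputable def riemannXiDeriv (n : ℕ) (s : ℂ) : ℂ :=
  ((s ^ 2 - s) * completedZetaDeriv n s + n * (2 * s - 1) * completedZetaDeriv (n - 1) s +
    n * (n - 1) * completedZetaDeriv (n - 2) s + if n = 0 then 1 else 0) / 2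

theorem riemannXiDeriv_zero : riemannXiDeriv 0 = riemannXi := by
  funext s
  rw [riemannXi, ← completedZetaDeriv_zero, riemannXiDeriv, if_pos rfl]
  push_cast
  ring

theorem hasDerivAt_riemannXiDeriv (n : ℕ) (s : ℂ) :
    HasDerivAt (riemannXiDeriv n) (riemannXiDeriv (n + 1) s) s := by
  have hq : HasDerivAt (fun s : ℂ ↦ s ^ 2 - s) (2 * s - 1) s := by
    refine ((hasDerivAt_pow 2 s).sub (hasDerivAt_id s)).congr_deriv ?_
    simp
  have hl : HasDerivAt (fun s : ℂ ↦ n * (2 * s - 1)) ((n : ℂ) * 2) s := by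
    simpa using (((hasDerivAt_id s).const_mul 2).sub_const 1).const_mul (n : ℂ)
  have h := ((((hq.mul (hasDerivAt_completedZetaDeriv n s)).add
    (hl.mul (hasDerivAt_completedZetaDeriv (n - 1) s))).add
    ((hasDerivAt_completedZetaDeriv (n - 2) s).const_mul ((n : ℂ) * (n - 1)))).add_const
    (if n = 0 then 1 else 0 : ℂ)).div_const 2
  refine h.congr_deriv ?_
  rw [riemannXiDeriv]
  rcases n with _ | _ | n
  · simp
    ring
  · simp
    ring
  · simp only [Nat.add_sub_cancel, show n + 1 + 1 - 1 = n + 1 by omega,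
      show n + 1 + 1 - 2 = n by omega, show n + 1 + 1 + 1 - 2 = n + 1 by omega,
      Nat.succ_ne_zero, if_false]
    push_cast
    ring

theorem iteratedDeriv_riemannXi_one (n : ℕ) :
    iteratedDeriv n riemannXi 1 = riemannXiDeriv n 1 := by
  rw [← riemannXiDeriv_zero, iteratedDeriv_eq_of_hasDerivAt_succ hasDerivAt_riemannXiDeriv]

/-! ### The coefficients `φ_n` and `λ_1` -/

/-- The binomial sum for `φ_{n + 1}` over the Taylor coefficients of `2 ξ` at `1`. -/
theorem phiCoeff_succ (n : ℕ) :
    phiCoeff (n + 1) = ∑ k ∈ Finset.range (n + 1),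
      (n.choose k : ℂ) * (2 * riemannXiDeriv (k + 1) 1 / ((k + 1).factorial : ℂ)) := by
  have h := iteratedDeriv_succ_comp_one_div_one_sub (G := fun s ↦ 2 * riemannXi s)
    (F := fun j s ↦ 2 * riemannXiDeriv j s) (by simp [riemannXiDeriv_zero])
    (fun j s ↦ (hasDerivAt_riemannXiDeriv j s).const_mul 2) n (z := 0) zero_ne_one
  have hf : ((n + 1).factorial : ℂ) ≠ 0 := by exact_mod_cast (n + 1).factorial_ne_zero
  rw [phiCoeff, show xiPartition = fun z ↦ 2 * riemannXi (1 / (1 - z)) from rfl, h,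
    mul_div_cancel_left₀ _ hf]
  refine Finset.sum_congr rfl fun k _ ↦ ?_
  simp only [sub_zero, div_one, one_pow, one_mul]
  ring

theorem xiPartition_zero : xiPartition 0 = 1 := by
  simp [xiPartition, riemannXi_one]

theorem differentiableAt_xiPartition_zero : DifferentiableAt ℂ xiPartition 0 := by
  have h : DifferentiableAt ℂ (fun z : ℂ ↦ 1 / (1 - z)) 0 :=
    (differentiableAt_const _).div (by fun_prop) (by simp)
  exact ((differentiable_riemannXi _).comp (0 : ℂ) h).const_mul 2

/-- Since `xiPartition 0 = 1`, passing to the logarithm does not change the first derivative. -/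
theorem liKeiper_one_eq_phiCoeff_one : liKeiper 1 = phiCoeff 1 := by
  have h := differentiableAt_xiPartition_zero.hasDerivAt.clog (by simp [xiPartition_zero])
  simp [liKeiper, phiCoeff, iteratedDeriv_one, h.deriv, xiPartition_zero]

theorem phiCoeff_one : phiCoeff 1 = completedZetaDeriv 0 1 := by
  rw [phiCoeff_succ 0]
  simp [riemannXiDeriv]
  ring

theorem liKeiper_one : liKeiper 1 = completedZetaDeriv 0 1 :=
  liKeiper_one_eq_phiCoeff_one.trans phiCoeff_one

/-! ### The coefficients `δ_k` -/

theorem xiDelta_two : xiDelta 2 = completedZetaDeriv 1 1 := by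
  rw [xiDelta, if_pos rfl, iteratedDeriv_riemannXi_one, riemannXi_one, liKeiper_one,
    riemannXiDeriv]
  simp
  ring

/-- The Taylor coefficient of `2 ξ` at `1` of order two exceeds `δ_2` by `λ_1`; this is the source of
`n - 1` of the `n` copies of `λ_1` in `φ_n`. -/
theorem two_mul_riemannXiDeriv_two_div :
    2 * riemannXiDeriv 2 1 / ((2 : ℕ).factorial : ℂ) = xiDelta 2 + liKeiper 1 := by
  rw [xiDelta_two, liKeiper_one, riemannXiDeriv]
  simp
  ring

theorem two_mul_riemannXiDeriv_div {k : ℕ} (hk : 3 ≤ k) :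
    2 * riemannXiDeriv k 1 / (k.factorial : ℂ) = xiDelta k := by
  rw [xiDelta, if_neg (by omega), iteratedDeriv_riemannXi_one, riemannXi_one]
  have hf : (k.factorial : ℂ) ≠ 0 := by exact_mod_cast k.factorial_ne_zero
  field_simp

/-- In terms of the Taylor coefficients `c_j` of `completedRiemannZeta₀` at `1`, `δ_2 = c_1`, and
`δ_k = c_{k-1} + c_{k-2}` for `k ≥ 3`. -/
theorem xiDelta_pos {k : ℕ} (hk : 2 ≤ k) : 0 < xiDelta k := by
  obtain ⟨m, rfl⟩ := Nat.exists_eq_add_of_le' hk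
  rcases m with _ | m
  · exact xiDelta_two ▸ completedZetaDeriv_one_pos 1
  · have h2 : (0 : ℂ) < ((m + 3 : ℕ) : ℂ) := by exact_mod_cast Nat.succ_pos _
    have h3 : (0 : ℂ) < ((m + 2 : ℕ) : ℂ) := by exact_mod_cast Nat.succ_pos _
    have hf : (0 : ℂ) < ((m + 3).factorial : ℂ) := by exact_mod_cast (m + 3).factorial_pos
    have hval : 2 * riemannXiDeriv (m + 3) 1 = ((m + 3 : ℕ) : ℂ) * completedZetaDeriv (m + 2) 1 +
        ((m + 3 : ℕ) : ℂ) * ((m + 2 : ℕ) : ℂ) * completedZetaDeriv (m + 1) 1 := by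
      simp only [riemannXiDeriv, show m + 3 - 1 = m + 2 by omega,
        show m + 3 - 2 = m + 1 by omega, show m + 3 ≠ 0 by omega, if_false]
      push_cast
      ring
    rw [← two_mul_riemannXiDeriv_div (k := m + 1 + 2) (by omega)]
    change 0 < 2 * riemannXiDeriv (m + 3) 1 / ((m + 3).factorial : ℂ)
    rw [hval, div_eq_mul_inv]
    exact mul_pos (add_pos (mul_pos h2 (completedZetaDeriv_one_pos _))
      (mul_pos (mul_pos h2 h3) (completedZetaDeriv_one_pos _))) (inv_pos.mpr hf)

/-! ### The excess `ε_n` -/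

theorem phiCoeff_succ_eq {m : ℕ} (hm : 1 ≤ m) :
    phiCoeff (m + 1) = ((m + 1 : ℕ) : ℂ) * liKeiper 1 +
      ∑ k ∈ Finset.Icc 1 m, (m.choose k : ℂ) * xiDelta (k + 1) := by
  have hIcc : ∀ f : ℕ → ℂ, ∑ k ∈ Finset.Icc 1 m, f k = f 1 + ∑ k ∈ Finset.Icc 2 m, f k :=
    fun f ↦ (Finset.add_sum_Ioc_eq_sum_Icc hm).symm
  have h1 : phiCoeff 1 = 2 * riemannXiDeriv 1 1 := by simp [phiCoeff_succ 0]
  rw [phiCoeff_succ, Finset.range_eq_Ico, Finset.sum_eq_sum_Ico_succ_bot (Nat.succ_pos m),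
    show Finset.Ico (0 + 1) (m + 1) = Finset.Icc 1 m from rfl, hIcc, hIcc]
  have hsum : ∑ k ∈ Finset.Icc 2 m,
        (m.choose k : ℂ) * (2 * riemannXiDeriv (k + 1) 1 / ((k + 1).factorial : ℂ)) =
      ∑ k ∈ Finset.Icc 2 m, (m.choose k : ℂ) * xiDelta (k + 1) :=
    Finset.sum_congr rfl fun k hk ↦ by
      rw [two_mul_riemannXiDeriv_div (by have := (Finset.mem_Icc.mp hk).1; omega)]
  rw [hsum, two_mul_riemannXiDeriv_two_div, zero_add, ← h1, ← liKeiper_one_eq_phiCoeff_one]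
  simp
  ring

theorem phiExcess_eq {n : ℕ} (hn : 1 < n) :
    phiExcess n = ∑ k ∈ Finset.Icc 1 (n - 1), ((n - 1).choose k : ℂ) * xiDelta (k + 1) := by
  obtain ⟨m, rfl⟩ := Nat.exists_eq_add_of_lt hn
  rw [phiExcess, show 1 + m + 1 = (m + 1) + 1 by ring, phiCoeff_succ_eq (by omega),
    Nat.add_sub_cancel, add_sub_cancel_left]

theorem phiExcess_pos {n : ℕ} (hn : 1 < n) : 0 < phiExcess n := by
  rw [phiExcess_eq hn]
  refine Finset.sum_pos (fun k hk ↦ ?_) ⟨1, Finset.mem_Icc.mpr ⟨le_rfl, by omega⟩⟩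
  obtain ⟨hk1, hk2⟩ := Finset.mem_Icc.mp hk
  have hc : (0 : ℂ) < ((n - 1).choose k : ℂ) := by exact_mod_cast Nat.choose_pos hk2
  exact mul_pos hc (xiDelta_pos (by omega))

theorem phiExcess_lt {m n : ℕ} (hm : 1 < m) (hmn : m < n) : phiExcess m < phiExcess n := by
  rw [phiExcess_eq hm, phiExcess_eq (hm.trans hmn)]
  have hd : ∀ k ∈ Finset.Icc 1 (n - 1), 0 < xiDelta (k + 1) := fun k hk ↦
    xiDelta_pos (by have := (Finset.mem_Icc.mp hk).1; omega)
  -- All terms grow weakly with `n` and there are more of them; the term `k = 1` grows strictly,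
  -- because `(n - 1).choose 1 = n - 1`.
  have hsub : Finset.Icc 1 (m - 1) ⊆ Finset.Icc 1 (n - 1) :=
    Finset.Icc_subset_Icc_right (by omega)
  refine lt_of_lt_of_le (Finset.sum_lt_sum (fun k hk ↦ ?_) ⟨1, ?_, ?_⟩)
    (Finset.sum_le_sum_of_subset_of_nonneg hsub fun k hk _ ↦ ?_)
  · have hc : ((m - 1).choose k : ℂ) ≤ ((n - 1).choose k : ℂ) := by
      exact_mod_cast Nat.choose_le_choose k (show m - 1 ≤ n - 1 by omega)
    exact mul_le_mul_of_nonneg_right hc (hd k (hsub hk)).le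
  · exact Finset.mem_Icc.mpr ⟨le_rfl, by omega⟩
  · have hc : ((m - 1).choose 1 : ℂ) < ((n - 1).choose 1 : ℂ) := by
      rw [Nat.choose_one_right, Nat.choose_one_right]
      exact_mod_cast (show m - 1 < n - 1 by omega)
    exact mul_lt_mul_of_pos_right hc (xiDelta_pos le_rfl)
  · exact mul_nonneg (by exact_mod_cast Nat.zero_le _) (hd k hk).le

theorem mainTheorem2 :
    liKeiper 1 =
        ((1 + Real.eulerMascheroniConstant / 2 - 1 / 2 * Real.log (4 * Real.pi) : ℝ) : ℂ) ∧
      phiCoeff 1 = liKeiper 1 ∧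
      (∀ k : ℕ, 2 ≤ k → 0 < xiDelta k) ∧
      (∀ n : ℕ, 1 < n →
        phiCoeff n = (n : ℂ) * liKeiper 1 +
          ∑ k ∈ Finset.Icc 1 (n - 1), ((n - 1).choose k : ℂ) * xiDelta (k + 1)) ∧
      (∀ n : ℕ, 1 < n →
        phiExcess n = ∑ k ∈ Finset.Icc 1 (n - 1), ((n - 1).choose k : ℂ) * xiDelta (k + 1)) ∧
      (∀ n : ℕ, 1 < n → 0 < phiExcess n) ∧
      (∀ m n : ℕ, 1 < m → m < n → phiExcess m < phiExcess n) ∧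
      (∀ n : ℕ, 1 < n → (n : ℂ) * liKeiper 1 < phiCoeff n) := by
  refine ⟨?_, liKeiper_one_eq_phiCoeff_one.symm, fun k ↦ xiDelta_pos, fun n hn ↦ ?_,
    fun n ↦ phiExcess_eq, fun n ↦ phiExcess_pos, fun m n ↦ phiExcess_lt,
    fun n hn ↦ sub_pos.mp (phiExcess_pos hn)⟩
  · rw [liKeiper_one, completedZetaDeriv_zero, completedRiemannZeta₀_one]
    push_cast [Complex.ofReal_log (show (0 : ℝ) ≤ 4 * Real.pi by positivity)]
    ring
  · rw [← phiExcess_eq hn, phiExcess]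
    ring
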